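/- All trees are finite. A repetition is a sequence $x_1\dots x_h x_1\dots x_h$ with $h\ge 1$. A coloring $f:V(G)\to\mathbb N$ of a graph $G$ is nonrepetitive if for no simple path of $G$ the sequence of colors along the path contains a repetition as a block of consecutive terms. Given lists $(L_v)_{v\in V(G)}$ (finite sets of colors), $f$ is chosen from the lists if $f(v)\in L_v$ for all $v$. The Thue choice number $\pi_l(G)$ is the least $k$ such that for all lists with $|L_v|\ge k$ for every $v$ there is a nonrepetitive coloring of $G$ chosen from the lists. For $0<\delta<1$, a sequence is of the form $x^{1+\delta}$ if for some $n\ge 1$ it is $x_1\dots x_n x_1\dots x_m$ with $m=\lceil \delta n\rceil$. In a rooted tree, a simple path is vertical if one of its ends lies on the simple path from its other end to the root. Theorem. (1) For every real $\varepsilon>0$ there is a constant $c$ such that for every integer $\Delta\ge 1$ and every tree $T$ with maximum degree at most $\Delta$, $\pi_l(T)\le c\Delta^{1+\varepsilon}$; that is, from any lists with $|L_v|\ge c\Delta^{1+\varepsilon}$ for every vertex $v$ one can choose a nonrepetitive coloring of $T$. (2) Let $0<\varepsilon<1$ and let $\delta$ be given by $1+\varepsilon=\frac{1+\delta}{1-\delta}$.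 There is a constant $c$ such that for every integer $\Delta\ge 1$, every rooted tree $T$ with maximum degree at most $\Delta$ and all lists with $|L_v|\ge c\Delta^{1+\varepsilon}$ for every vertex $v$, there is a nonrepetitive coloring of $T$ chosen from the lists such that no vertical path has a color sequence of the form $x^{1+\delta}$. -/

import Mathlib

namespace ThueChoice

/-- A sequence of the form `x₁ … x_h x₁ … x_h` with `h ≥ 1`. -/
def IsRepetition {α : Type*} (s : List α) : Prop :=
  ∃ x : List α, x ≠ [] ∧ s = x ++ x

/-- A sequence none of whose blocks of consecutive terms is a repetition. -/
def IsNonrepetitive {α : Type*} (s : List α) : Prop :=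
  ∀ t : List α, t <:+: s → ¬ IsRepetition t

/-- A sequence of the form `x^r`: it consists of `⌈r⌉` blocks, of which all but the last are equal
to a nonempty base `b`, and the last is the prefix of `b` of length `⌈ρ * |b|⌉`, where
`ρ = r - (⌈r⌉ - 1) ∈ (0, 1]` is the fractional part of `r`, read as `1` when `r` is an integer
(so that `x^2` means `x x`). -/
def IsPower {α : Type*} (r : ℝ) (s : List α) : Prop :=
  ∃ b : List α, b ≠ [] ∧
    s = (List.replicate (⌈r⌉₊ - 1) b).flatten ++
      b.take ⌈(r - ((⌈r⌉₊ : ℝ) - 1)) * (b.length : ℝ)⌉₊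

theorem isPower_two_iff {α : Type*} (s : List α) : IsPower 2 s ↔ IsRepetition s := by
  have h : ⌈(2 : ℝ)⌉₊ = 2 := by exact_mod_cast Nat.ceil_natCast (R := ℝ) 2
  simp only [IsPower, IsRepetition, h]
  norm_num

variable {V : Type*}

/-- No repetition occurs in the color sequence of any simple path of `G`. -/
def IsNonrepetitiveColoring (G : SimpleGraph V) (f : V → ℕ) : Prop :=
  ∀ (u v : V) (p : G.Walk u v), p.IsPath → IsNonrepetitive (p.support.map f)

/-- The coloring `f` is chosen from the lists `L`. -/
def IsChosenFrom (f : V → ℕ) (L : V → Finset ℕ) : Prop :=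
  ∀ v : V, f v ∈ L v

/-- From any lists of size at least `k` a nonrepetitive coloring of `G` can be chosen. -/
def IsThueChoosable (G : SimpleGraph V) (k : ℕ) : Prop :=
  ∀ L : V → Finset ℕ, (∀ v : V, k ≤ (L v).card) →
    ∃ f : V → ℕ, IsChosenFrom f L ∧ IsNonrepetitiveColoring G f

/-- The Thue choice number `π_l(G)`: the minimum `k` such that from any lists of size at least `k`
a nonrepetitive coloring can be chosen. For a finite graph such a `k` exists, see
`exists_isThueChoosable`. -/
noncomputable def thueChoiceNumber (G : SimpleGraph V) : ℕ :=
  sInf {k : ℕ | IsThueChoosable G k}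

theorem exists_isThueChoosable [Fintype V] (G : SimpleGraph V) :
    ∃ k : ℕ, IsThueChoosable G k := by
  classical
  refine ⟨Fintype.card V, fun L hL => ?_⟩
  have hall : ∀ s : Finset V, s.card ≤ (s.biUnion L).card := by
    intro s
    rcases s.eq_empty_or_nonempty with rfl | ⟨v, hv⟩
    · simp
    · exact (Finset.card_le_univ s).trans
        ((hL v).trans (Finset.card_le_card (Finset.subset_biUnion_of_mem L hv)))
  obtain ⟨f, hf, hfL⟩ := (Finset.all_card_le_biUnion_card_iff_exists_injective L).1 hall
  refine ⟨f, hfL, fun u v p hp t ht hrep => ?_⟩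
  obtain ⟨x, hx, rfl⟩ := hrep
  have hnd : (x ++ x).Nodup := (hp.support_nodup.map hf).sublist ht.sublist
  obtain ⟨a, ha⟩ := List.exists_mem_of_ne_nil x hx
  exact (List.nodup_append.1 hnd).2.2 a ha a ha rfl

theorem isThueChoosable_thueChoiceNumber [Fintype V] (G : SimpleGraph V) :
    IsThueChoosable G (thueChoiceNumber G) :=
  Nat.sInf_mem (s := {k : ℕ | IsThueChoosable G k}) (exists_isThueChoosable G)

/-- In the tree `G` with root `root`, the vertex `u` is a descendant of `v`: the simple path
from `u` to the root contains `v`. -/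
def IsDescendant (G : SimpleGraph V) (root u v : V) : Prop :=
  ∃ p : G.Walk u root, p.IsPath ∧ v ∈ p.support

/-- In the tree `G` with root `root`, no color sequence of a vertical path (a simple path one of
whose ends is a descendant of the other) is of the form `x^r`. -/
def IsVerticallyPowerFree (G : SimpleGraph V) (root : V) (r : ℝ) (f : V → ℕ) : Prop :=
  ∀ (u v : V) (p : G.Walk u v), p.IsPath →
    (IsDescendant G root u v ∨ IsDescendant G root v u) → ¬ IsPower r (p.support.map f)

end ThueChoice

/-!
The proof is a counting argument in the style of Rosenfeld, combined with a reduction from trees to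
single branches.

*Reduction to sequences.* Suppose no coloring from the lists is admissible. Call a partially
colored tree stuck at a vertex `v` if nothing below `v` is colored and no coloring of the subtree
below `v` completes it. If `v` receives an admissible color, then its subtrees cannot all be
completed one after the other, so the process is stuck again at a child of `v`
(`State.Stuck.exists_step`). Fixing the choices made here, a sequence of colors determines a branch
that descends from the root, together with the coloring of everything that hangs off this branch;
and what hangs off at a vertex depends only on the colors given down to that vertex
(`State.Good.drop_state`). Since branches have bounded length, it suffices to show that there are
admissible sequences of every length.

*Counting.* The number of admissible sequences grows by a factor `β = 16 * Δ ^ (1 + ε)` with every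
letter (`mul_card_goodLists_le`): a color that is not admissible creates a forbidden path that ends
at the new vertex, and erasing the letters on part of that path loses little information. For a
vertical path of the form `x^(1+δ)` with base length `n`, the last `⌈δ * n⌉` letters are erased and
can be recovered from the rest. Consider a repetition with `2 * h` vertices on a path that climbs
`a` steps from the new vertex and descends `b` steps. The descending leg contains no forbidden
vertical path, hence `a > (1 - δ) * h` (`State.bent_length_lt`) and `b < (1 + δ) * h`. Once the
lower end of the descending leg is known, which leaves at most `Δ ^ b` possibilities, the last
`min a h` letters can be erased and recovered from the other half of the path
(`State.getElem?_of_bent`). As `(1 + ε) * (min a h) ≥ b` by the choice of `δ`, the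
`Δ ^ b` possibilities are paid for by the growth `β ^ (min a h)`, and the remaining powers of `16`
make the sum over all defects converge (`sum_defects_le`).

Vertical repetitions need no separate treatment, because they contain a path of the form `x^(1+δ)`.
Both forbidden patterns say that a sequence of given length has a given period, so the direction in
which a path is read is irrelevant. The first part of the theorem follows from the second.
-/

namespace ThueChoice

/-! ### Counting lists with erasable defects -/

section Counting

variable {α ι : Type*}

/-- The lists of length `t`, newest entry first, all of whose nonempty tails, including the list
itself, satisfy `good`, where the entry put in front of a list `l` comes from the finite set `A l`. -/
noncomputable def goodLists (A : List α → Finset α) (good : List α → Prop) : ℕ → Finset (List α)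
  | 0 => {[]}
  | t + 1 =>
    open Classical in
    ((goodLists A good t).biUnion fun l => (A l).image fun c => c :: l).filter good

theorem mem_goodLists_succ {A : List α → Finset α} {good : List α → Prop} {t : ℕ} {x : List α} :
    x ∈ goodLists A good (t + 1) ↔
      (∃ l ∈ goodLists A good t, ∃ c ∈ A l, c :: l = x) ∧ good x := by
  classical
  simp [goodLists]

theorem length_of_mem_goodLists {A : List α → Finset α} {good : List α → Prop} :
    ∀ {t : ℕ} {x : List α}, x ∈ goodLists A good t → x.length = t
  | 0, x, hx => by
    have : x = [] := by simpa [goodLists] using hx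
    simp [this]
  | t + 1, x, hx => by
    obtain ⟨⟨l, hl, c, -, rfl⟩, -⟩ := mem_goodLists_succ.1 hx
    simp [length_of_mem_goodLists hl]

theorem good_of_mem_goodLists {A : List α → Finset α} {good : List α → Prop} (h0 : good []) :
    ∀ {t : ℕ} {x : List α}, x ∈ goodLists A good t → good x
  | 0, x, hx => by
    have : x = [] := by simpa [goodLists] using hx
    rwa [this]
  | t + 1, x, hx => (mem_goodLists_succ.1 hx).2

theorem drop_mem_goodLists {A : List α → Finset α} {good : List α → Prop} :
    ∀ {s t : ℕ} {x : List α}, x ∈ goodLists A good t → s ≤ t →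
      x.drop s ∈ goodLists A good (t - s)
  | 0, t, x, hx, _ => by simpa using hx
  | s + 1, 0, x, hx, h => by omega
  | s + 1, t + 1, x, hx, h => by
    obtain ⟨⟨l, hl, c, -, rfl⟩, -⟩ := mem_goodLists_succ.1 hx
    have := drop_mem_goodLists (s := s) hl (by omega)
    simpa using this

/-- Rosenfeld's counting argument. Every one-letter extension of a good list that is not good has a
defect `i ∈ I`; a list with defect `i` is determined, up to `N i` possibilities, by what remains
after its `s i` newest letters are deleted. If there are enough letters to choose from, the number
of good lists grows at least by the factor `β` with every letter. -/
theorem mul_card_goodLists_le (A : List α → Finset α) (good : List α → Prop) (h0 : good [])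
    (I : Finset ι) (s N : ι → ℕ) (defect : ι → List α → Prop) (β : ℝ) (hβ : 0 < β)
    (hA : ∀ l, good l → β + ∑ i ∈ I, (N i : ℝ) * (β ^ (s i - 1))⁻¹ ≤ ((A l).card : ℝ))
    (hbad : ∀ l, good l → ∀ c ∈ A l, ¬ good (c :: l) → ∃ i ∈ I, defect i (c :: l))
    (hs : ∀ i x, defect i x → 1 ≤ s i ∧ s i ≤ x.length)
    (hN : ∀ i l', good l' → ∀ X : Finset (List α),
      (∀ x ∈ X, defect i x ∧ x.drop (s i) = l' ∧ ∃ l c, x = c :: l ∧ good l ∧ c ∈ A l) →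
        X.card ≤ N i)
    (t : ℕ) :
    β * (goodLists A good t).card ≤ ((goodLists A good (t + 1)).card : ℝ) := by
  classical
  induction t using Nat.strong_induction_on with
  | _ t ih =>
  set C := goodLists A good with hC
  -- the growth accumulated over several letters
  have hgrow : ∀ j, j ≤ t → β ^ j * ((C (t - j)).card : ℝ) ≤ (C t).card := by
    intro j
    induction j with
    | zero => simp
    | succ j ihj =>
      intro hj
      have h1 := ih (t - (j + 1)) (by omega)
      rw [show t - (j + 1) + 1 = t - j by omega] at h1
      calc β ^ (j + 1) * ((C (t - (j + 1))).card : ℝ)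
          = β ^ j * (β * ((C (t - (j + 1))).card : ℝ)) := by ring
        _ ≤ β ^ j * ((C (t - j)).card : ℝ) := by gcongr
        _ ≤ _ := ihj (by omega)
  set E : Finset (List α) := (C t).biUnion fun l => (A l).image fun c => c :: l with hE
  have hEcard : (E.card : ℝ) = ∑ l ∈ C t, ((A l).card : ℝ) := by
    rw [hE, Finset.card_biUnion]
    · push_cast
      refine Finset.sum_congr rfl fun l _ => ?_
      rw [Finset.card_image_of_injective _ fun c d h => by simpa using h]
    · intro l _ l' _ hne
      rw [Function.onFun, Finset.disjoint_left]
      rintro x hx hx'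
      obtain ⟨c, -, rfl⟩ := Finset.mem_image.1 hx
      obtain ⟨d, -, h⟩ := Finset.mem_image.1 hx'
      exact hne (by simpa using (List.cons.inj h).2.symm)
  have hEmem : ∀ x ∈ E, ∃ l ∈ C t, ∃ c ∈ A l, c :: l = x := by
    intro x hx
    simpa [hE] using hx
  have hsub : E ⊆ C (t + 1) ∪ I.biUnion fun i => E.filter (defect i) := by
    intro x hx
    obtain ⟨l, hl, c, hc, rfl⟩ := hEmem x hx
    by_cases hg : good (c :: l)
    · exact Finset.mem_union_left _ (mem_goodLists_succ.2 ⟨⟨l, hl, c, hc, rfl⟩, hg⟩)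
    · obtain ⟨i, hi, hd⟩ := hbad l (good_of_mem_goodLists h0 hl) c hc hg
      exact Finset.mem_union_right _ (Finset.mem_biUnion.2 ⟨i, hi, Finset.mem_filter.2 ⟨hx, hd⟩⟩)
  have hB : ∀ i ∈ I, ((E.filter (defect i)).card : ℝ) ≤
      (N i : ℝ) * (β ^ (s i - 1))⁻¹ * (C t).card := by
    intro i _
    rcases (E.filter (defect i)).eq_empty_or_nonempty with he | ⟨x₀, hx₀⟩
    · rw [he]; simp; positivity
    have hlen : ∀ x ∈ E, x.length = t + 1 := by
      intro x hx
      obtain ⟨l, hl, c, -, rfl⟩ := hEmem x hx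
      simp [length_of_mem_goodLists hl]
    obtain ⟨hs1, hs2⟩ := hs i x₀ (Finset.mem_filter.1 hx₀).2
    rw [hlen x₀ (Finset.mem_filter.1 hx₀).1] at hs2
    have hmaps : ∀ x ∈ E.filter (defect i), x.drop (s i) ∈ C (t - (s i - 1)) := by
      intro x hx
      obtain ⟨l, hl, c, -, rfl⟩ := hEmem x (Finset.mem_filter.1 hx).1
      obtain ⟨j, hj⟩ : ∃ j, s i = j + 1 := ⟨s i - 1, by omega⟩
      rw [hj, List.drop_succ_cons]
      exact drop_mem_goodLists hl (by omega)
    have hfib : (E.filter (defect i)).card ≤ N i * (C (t - (s i - 1))).card := by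
      refine Finset.card_le_mul_card_image_of_maps_to hmaps _ fun l' hl' => ?_
      refine hN i l' (good_of_mem_goodLists h0 hl') _ fun x hx => ?_
      obtain ⟨hx1, hx2⟩ := Finset.mem_filter.1 hx
      obtain ⟨l, hl, c, hc, rfl⟩ := hEmem x (Finset.mem_filter.1 hx1).1
      exact ⟨(Finset.mem_filter.1 hx1).2, hx2, l, c, rfl, good_of_mem_goodLists h0 hl, hc⟩
    have hg := hgrow (s i - 1) (by omega)
    calc ((E.filter (defect i)).card : ℝ) ≤ N i * ((C (t - (s i - 1))).card : ℝ) := by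
          exact_mod_cast hfib
      _ ≤ N i * ((β ^ (s i - 1))⁻¹ * (C t).card) := by
          gcongr
          rw [inv_mul_eq_div, le_div_iff₀ (by positivity), mul_comm]
          exact hg
      _ = _ := by ring
  have h1 : (E.card : ℝ) ≤ (C (t + 1)).card + ∑ i ∈ I, ((E.filter (defect i)).card : ℝ) := by
    have h2 := (Finset.card_le_card hsub).trans (Finset.card_union_le _ _)
    have h3 := h2.trans (Nat.add_le_add_left Finset.card_biUnion_le _)
    exact_mod_cast h3
  have h2 : (β + ∑ i ∈ I, (N i : ℝ) * (β ^ (s i - 1))⁻¹) * (C t).card ≤ E.card := by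
    rw [hEcard, mul_comm, ← nsmul_eq_mul]
    exact Finset.card_nsmul_le_sum _ _ _ fun l hl => hA l (good_of_mem_goodLists h0 hl)
  have h3 := Finset.sum_le_sum hB
  rw [← Finset.sum_mul] at h3
  linarith

end Counting

/-! ### Rooted trees as parent maps -/

section Rooted

/-- A rooted tree on `V`, given by its parent map. The root is its own parent, and `dep` is the
distance to the root. -/
structure ParentMap (V : Type*) where
  /-- the root -/
  root : V
  /-- the parent of a vertex -/
  par : V → V
  /-- the depth of a vertex -/
  dep : V → ℕ
  par_root : par root = root
  dep_root : dep root = 0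
  dep_par : ∀ x, x ≠ root → dep (par x) + 1 = dep x

namespace ParentMap

variable {V : Type*} (T : ParentMap V)

theorem dep_par_eq (x : V) : T.dep (T.par x) = T.dep x - 1 := by
  by_cases h : x = T.root
  · rw [h, T.par_root, T.dep_root]
  · have := T.dep_par x h
    omega

theorem dep_iterate (i : ℕ) (x : V) : T.dep (T.par^[i] x) = T.dep x - i := by
  induction i with
  | zero => rfl
  | succ i ih => rw [Function.iterate_succ_apply', T.dep_par_eq, ih]; omega

theorem eq_root_of_dep {x : V} (h : T.dep x = 0) : x = T.root := by
  by_contra hx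
  have := T.dep_par x hx
  omega

theorem iterate_dep (x : V) : T.par^[T.dep x] x = T.root :=
  T.eq_root_of_dep (by rw [T.dep_iterate]; omega)

theorem dep_lt_card [Fintype V] (x : V) : T.dep x < Fintype.card V := by
  have hinj : Function.Injective fun i : Fin (T.dep x + 1) => T.par^[(i : ℕ)] x := by
    intro i j h
    have := congrArg T.dep h
    simp only [T.dep_iterate] at this
    ext
    omega
  simpa using Fintype.card_le_of_injective _ hinj

/-- The descendants of `v`, including `v` itself. -/
def desc (v : V) : Set V := {x | ∃ i, T.par^[i] x = v}

variable {T}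

theorem self_mem_desc (v : V) : v ∈ T.desc v := ⟨0, rfl⟩

theorem mem_desc_root (x : V) : x ∈ T.desc T.root := ⟨_, T.iterate_dep x⟩

theorem par_mem_desc {x v : V} (h : x ∈ T.desc v) (hne : x ≠ v) : T.par x ∈ T.desc v := by
  obtain ⟨i, hi⟩ := h
  cases i with
  | zero => exact absurd hi hne
  | succ i => exact ⟨i, by rwa [← Function.iterate_succ_apply]⟩

theorem desc_trans {x y z : V} (h : x ∈ T.desc y) (h' : y ∈ T.desc z) : x ∈ T.desc z := by
  obtain ⟨i, rfl⟩ := h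
  obtain ⟨j, rfl⟩ := h'
  exact ⟨j + i, by rw [Function.iterate_add_apply]⟩

/-- The exponent of the iterate witnessing that `v` is an ancestor of `x` can be taken to be the
difference of the depths. -/
theorem iterate_of_mem_desc {x v : V} (h : x ∈ T.desc v) :
    T.dep v ≤ T.dep x ∧ T.par^[T.dep x - T.dep v] x = v := by
  obtain ⟨i, rfl⟩ := h
  rw [T.dep_iterate]
  refine ⟨Nat.sub_le _ _, ?_⟩
  rcases le_total i (T.dep x) with h | h
  · congr 1
    omega
  · rw [Nat.sub_eq_zero_of_le h, Nat.sub_zero, T.iterate_dep]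
    exact (T.eq_root_of_dep (by rw [T.dep_iterate]; omega)).symm

theorem exists_child_of_mem_desc {x v : V} (h : x ∈ T.desc v) (hne : x ≠ v) :
    ∃ u, u ≠ T.root ∧ T.par u = v ∧ x ∈ T.desc u := by
  obtain ⟨h1, h2⟩ := iterate_of_mem_desc h
  obtain ⟨k, hk⟩ : ∃ k, T.dep x - T.dep v = k + 1 := by
    refine ⟨T.dep x - T.dep v - 1, ?_⟩
    have : T.dep x - T.dep v ≠ 0 := fun h0 => by
      rw [h0] at h2
      exact hne h2
    omega
  rw [hk, Function.iterate_succ_apply'] at h2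
  refine ⟨_, fun hr => ?_, h2, k, rfl⟩
  have := congrArg T.dep hr
  rw [T.dep_iterate, T.dep_root] at this
  omega

/-- Distinct children of a vertex have no common descendant. -/
theorem child_eq_of_mem_desc {x u u' : V} (hu : u ≠ T.root) (hu' : u' ≠ T.root)
    (h : T.par u = T.par u') (hx : x ∈ T.desc u) (hx' : x ∈ T.desc u') : u = u' := by
  obtain ⟨-, h2⟩ := iterate_of_mem_desc hx
  obtain ⟨-, h3⟩ := iterate_of_mem_desc hx'
  have h4 := T.dep_par u hu
  have h5 := T.dep_par u' hu'
  rw [h] at h4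
  rw [← h2, ← h3, ← h4, ← h5]

theorem card_iterate_le [Fintype V] [DecidableEq V] {Δ : ℕ}
    (hΔ : ∀ w, (Finset.univ.filter fun x => x ≠ T.root ∧ T.par x = w).card ≤ Δ) (b : ℕ) (w : V) :
    (Finset.univ.filter fun u => b ≤ T.dep u ∧ T.par^[b] u = w).card ≤ Δ ^ b := by
  induction b with
  | zero =>
    simp only [zero_le, true_and, Function.iterate_zero, id, pow_zero]
    rw [Finset.card_le_one]
    simp +contextual
  | succ b ih =>
    rw [pow_succ']
    have := Finset.card_le_mul_card_image_of_maps_to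
      (s := Finset.univ.filter fun u => b + 1 ≤ T.dep u ∧ T.par^[b + 1] u = w)
      (t := Finset.univ.filter fun u => b ≤ T.dep u ∧ T.par^[b] u = w)
      (f := T.par) (n := Δ) ?_ ?_
    · exact this.trans (Nat.mul_le_mul_left _ ih)
    · intro u hu
      simp only [Finset.mem_filter, Finset.mem_univ, true_and] at hu ⊢
      rw [T.dep_par_eq, ← Function.iterate_succ_apply]
      exact ⟨by omega, hu.2⟩
    · intro y _
      refine (Finset.card_le_card fun x hx => ?_).trans (hΔ y)
      simp only [Finset.mem_filter, Finset.mem_univ, true_and] at hx ⊢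
      refine ⟨?_, hx.2⟩
      rintro rfl
      rw [T.dep_root] at hx
      omega

variable (T)

/-- The path that starts at `x` and climbs towards the root begins with a sequence of colors of the
form `x^(1+δ)`, of base length `n` and total length `n + ⌈δ * n⌉`. This is expressed by the period
`n`, which makes the direction of reading irrelevant. -/
def VertBad (δ : ℝ) (f : V → ℕ) (x : V) (n : ℕ) : Prop :=
  1 ≤ n ∧ n + ⌈δ * n⌉₊ ≤ T.dep x + 1 ∧
    ∀ i < ⌈δ * n⌉₊, f (T.par^[i] x) = f (T.par^[i + n] x)

/-- The `i`-th vertex of the path that climbs `a` steps from `x` and then descends `b` steps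
to `y`. -/
def legVertex (x y : V) (a b i : ℕ) : V :=
  if i ≤ a then T.par^[i] x else T.par^[a + b - i] y

/-- The path that climbs `a ≥ 1` steps from `x` and then descends `b ≥ 1` steps to `y` has
`2 * h` vertices, and its colors form a repetition. -/
structure BentBad (f : V → ℕ) (x y : V) (a b h : ℕ) : Prop where
  one_le_left : 1 ≤ a
  one_le_right : 1 ≤ b
  le_dep_left : a ≤ T.dep x
  le_dep_right : b ≤ T.dep y
  length : a + b + 1 = 2 * h
  top : T.par^[a] x = T.par^[b] y
  ne : T.par^[a - 1] x ≠ T.par^[b - 1] y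
  rep : ∀ i < h, f (T.legVertex x y a b i) = f (T.legVertex x y a b (i + h))

theorem legVertex_symm {x y : V} {a b : ℕ} (h : T.par^[a] x = T.par^[b] y) {i : ℕ}
    (hi : i ≤ a + b) : T.legVertex y x b a i = T.legVertex x y a b (a + b - i) := by
  unfold legVertex
  rcases lt_trichotomy i b with hb | hb | hb
  · rw [if_pos hb.le, if_neg (by omega)]
    congr 2
    omega
  · subst hb
    rw [if_pos le_rfl, if_pos (by omega), ← h]
    congr 2
    omega
  · rw [if_neg (by omega), if_pos (by omega)]
    congr 2
    omega

variable {T}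

theorem BentBad.symm {f : V → ℕ} {x y : V} {a b h : ℕ} (H : T.BentBad f x y a b h) :
    T.BentBad f y x b a h where
  one_le_left := H.one_le_right
  one_le_right := H.one_le_left
  le_dep_left := H.le_dep_right
  le_dep_right := H.le_dep_left
  length := by have := H.length; omega
  top := H.top.symm
  ne := H.ne.symm
  rep i hi := by
    have hl := H.length
    rw [T.legVertex_symm H.top (by omega), T.legVertex_symm H.top (by omega)]
    have := H.rep (a + b - (i + h)) (by omega)
    rw [this]
    congr 2
    omega

theorem BentBad.congr {f g : V → ℕ} {x y : V} {a b h : ℕ} (H : T.BentBad f x y a b h)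
    (hx : ∀ i, f (T.par^[i] x) = g (T.par^[i] x)) (hy : ∀ i, f (T.par^[i] y) = g (T.par^[i] y)) :
    T.BentBad g x y a b h :=
  { H with
    rep := by
      have : ∀ i, g (T.legVertex x y a b i) = f (T.legVertex x y a b i) := by
        intro i
        unfold legVertex
        split_ifs
        · exact (hx _).symm
        · exact (hy _).symm
      intro i hi
      rw [this, this, H.rep i hi] }

theorem BentBad.left_ne_right {f : V → ℕ} {x y : V} {a b h : ℕ} (H : T.BentBad f x y a b h) :
    x ≠ y := by
  rintro rfl
  have h1 := congrArg T.dep H.top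
  rw [T.dep_iterate, T.dep_iterate] at h1
  have := H.le_dep_left
  have := H.le_dep_right
  exact H.ne (by congr 2; omega)

/-- The descending leg of a bent path, below its top, contains no descendant of the vertices on the
climbing leg. -/
theorem BentBad.not_mem_desc {f : V → ℕ} {x y : V} {a b h : ℕ} (H : T.BentBad f x y a b h)
    {i j : ℕ} (hi : i < a) : T.par^[j] y ∉ T.desc (T.par^[i] x) := by
  intro hmem
  have h1 : y ∈ T.desc (T.par^[a - 1] x) :=
    desc_trans ⟨j, rfl⟩ (desc_trans hmem
      ⟨a - 1 - i, by rw [← Function.iterate_add_apply]; congr 2; omega⟩)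
  obtain ⟨h2, h3⟩ := iterate_of_mem_desc h1
  have h4 := congrArg T.dep H.top
  have := H.le_dep_left
  have := H.le_dep_right
  have := H.one_le_left
  have := H.one_le_right
  rw [T.dep_iterate] at h2 h3 h4
  rw [T.dep_iterate] at h4
  rw [show T.dep y - (T.dep x - (a - 1)) = b - 1 by omega] at h3
  exact H.ne h3.symm

end ParentMap
end Rooted

/-! ### States of the coloring process -/

section States

variable {V : Type*}

namespace ParentMap

/-- On the vertex set `S` the coloring `f` is chosen from the lists and has neither a forbidden
vertical path nor a bent path that carries a repetition. -/
structure ValidOn (T : ParentMap V) (δ : ℝ) (L : V → Finset ℕ) (S : Set V) (f : V → ℕ) :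
    Prop where
  mem : ∀ x ∈ S, f x ∈ L x
  vert : ∀ x ∈ S, ∀ n, ¬ T.VertBad δ f x n
  bent : ∀ x ∈ S, ∀ y ∈ S, ∀ a b h, ¬ T.BentBad f x y a b h

variable (T : ParentMap V)

theorem ValidOn.congr {T : ParentMap V} {δ : ℝ} {L : V → Finset ℕ} {S : Set V} {f g : V → ℕ}
    (H : T.ValidOn δ L S f) (hS : ∀ x ∈ S, T.par x ∈ S) (hfg : ∀ x ∈ S, g x = f x) :
    T.ValidOn δ L S g := by
  have hit : ∀ x ∈ S, ∀ i, g (T.par^[i] x) = f (T.par^[i] x) := by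
    intro x hx i
    refine hfg _ ?_
    induction i with
    | zero => exact hx
    | succ i ih => rw [Function.iterate_succ_apply']; exact hS _ ih
  refine ⟨fun x hx => hfg x hx ▸ H.mem x hx, fun x hx n hn => H.vert x hx n ⟨hn.1, hn.2.1, ?_⟩,
    fun x hx y hy a b h hB => H.bent x hx y hy a b h (hB.congr (hit x hx) (hit y hy))⟩
  intro i hi
  rw [← hit x hx, ← hit x hx, hn.2.2 i hi]

end ParentMap

/-- A state of the coloring process: the set `S` of colored vertices, their coloring `f` (whose
values outside `S` are irrelevant), and the vertex `v` to be colored next. -/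
structure State (V : Type*) where
  /-- the vertex to be colored next -/
  v : V
  /-- the colored vertices -/
  S : Set V
  /-- the coloring -/
  f : V → ℕ

namespace State

open Classical in
/-- The coloring of a state after the next vertex has received the color `c`. -/
noncomputable def recolor (σ : State V) (c : ℕ) : V → ℕ := Function.update σ.f σ.v c

/-- A state is stuck if its coloring is valid, nothing below the next vertex is colored, and no
coloring of the whole subtree below the next vertex completes it validly. -/
structure Stuck (T : ParentMap V) (δ : ℝ) (L : V → Finset ℕ) (σ : State V) : Prop where
  disj : ∀ x ∈ σ.S, x ∉ T.desc σ.v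
  par_mem : ∀ x ∈ σ.S, T.par x ∈ σ.S
  par_v_mem : σ.v ≠ T.root → T.par σ.v ∈ σ.S
  valid : T.ValidOn δ L σ.S σ.f
  stuck : ¬ ∃ g, (∀ x ∈ σ.S, g x = σ.f x) ∧ T.ValidOn δ L (σ.S ∪ T.desc σ.v) g

/-- The state `σ'` arises from `σ` when the next vertex receives the color `c`, some of the subtrees
below it are colored completely, and a child of it whose subtree is uncolored comes next. -/
structure Step (T : ParentMap V) (σ : State V) (c : ℕ) (σ' : State V) : Prop where
  v_ne : σ'.v ≠ T.root
  par_v : T.par σ'.v = σ.v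
  subset : insert σ.v σ.S ⊆ σ'.S
  sub_desc : ∀ x ∈ σ'.S, x ∈ σ.S ∨ x ∈ T.desc σ.v
  agree : ∀ x ∈ insert σ.v σ.S, σ'.f x = σ.recolor c x

variable {T : ParentMap V} {δ : ℝ} {L : V → Finset ℕ}

theorem Stuck.v_notMem {σ : State V} (hσ : σ.Stuck T δ L) : σ.v ∉ σ.S :=
  fun h => hσ.disj _ h (ParentMap.self_mem_desc _)

theorem recolor_v (σ : State V) (c : ℕ) : σ.recolor c σ.v = c := by
  classical
  simp [recolor]

theorem Stuck.recolor_eq {σ : State V} (hσ : σ.Stuck T δ L) (c : ℕ) {x : V} (hx : x ∈ σ.S) :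
    σ.recolor c x = σ.f x := by
  classical
  rw [recolor, Function.update_of_ne]
  rintro rfl
  exact hσ.v_notMem hx

/-- If the next vertex of a stuck state receives an admissible color, then the subtrees below it
cannot all be colored one after the other: at some child the process is stuck again. -/
theorem Stuck.exists_step [Finite V] {σ : State V} (hσ : σ.Stuck T δ L) {c : ℕ}
    (hc : T.ValidOn δ L (insert σ.v σ.S) (σ.recolor c)) :
    ∃ σ', σ.Step T c σ' ∧ σ'.Stuck T δ L := by
  classical
  let P : Set V → Prop := fun S' => insert σ.v σ.S ⊆ S' ∧ (∀ x ∈ S', x ∈ σ.S ∨ x ∈ T.desc σ.v) ∧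
    (∀ x ∈ S', T.par x ∈ S') ∧
    (∀ u, u ≠ T.root → T.par u = σ.v → u ∉ S' → ∀ x ∈ S', x ∉ T.desc u) ∧
    (∀ u, u ≠ T.root → T.par u = σ.v → u ∈ S' → T.desc u ⊆ S') ∧
    ∃ f', (∀ x ∈ insert σ.v σ.S, f' x = σ.recolor c x) ∧ T.ValidOn δ L S' f'
  have hpar : ∀ x ∈ insert σ.v σ.S, T.par x ∈ insert σ.v σ.S := by
    rintro x (rfl | hx)
    · by_cases h : σ.v = T.root
      · rw [h, T.par_root]
        exact Or.inl rfl
      · exact Or.inr (hσ.par_v_mem h)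
    · exact Or.inr (hσ.par_mem x hx)
  have hchild : ∀ u, u ≠ T.root → T.par u = σ.v → ∀ x ∈ insert σ.v σ.S, x ∉ T.desc u := by
    rintro u hu huv x (rfl | hx) hxu
    · have h1 := (ParentMap.iterate_of_mem_desc hxu).1
      have h2 := T.dep_par u hu
      rw [huv] at h2
      omega
    · exact hσ.disj x hx (ParentMap.desc_trans hxu ⟨1, huv⟩)
  have hP0 : P (insert σ.v σ.S) := by
    refine ⟨subset_rfl, ?_, hpar, fun u hu huv _ => hchild u hu huv, ?_, σ.recolor c,
      fun x _ => rfl, hc⟩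
    · rintro x (rfl | hx)
      · exact Or.inr (ParentMap.self_mem_desc _)
      · exact Or.inl hx
    · intro u hu huv hmem
      exact absurd (ParentMap.self_mem_desc u) (hchild u hu huv u hmem)
  -- color as many of the subtrees below the next vertex as possible
  obtain ⟨S', -, hmax⟩ := (Set.toFinite {S' | P S'}).exists_le_maximal hP0
  obtain ⟨hsub, hdesc, hup, hout, hin, f', hf', hval⟩ := hmax.prop
  have hex : ∃ u, u ≠ T.root ∧ T.par u = σ.v ∧ u ∉ S' := by
    by_contra! hall
    refine hσ.stuck ⟨f', fun x hx => ?_, ?_⟩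
    · rw [hf' x (Or.inr hx), hσ.recolor_eq c hx]
    · have : σ.S ∪ T.desc σ.v = S' := by
        apply Set.Subset.antisymm
        · rintro x (hx | hx)
          · exact hsub (Or.inr hx)
          · by_cases hxv : x = σ.v
            · exact hsub (Or.inl hxv)
            · obtain ⟨u, hu, huv, hxu⟩ := ParentMap.exists_child_of_mem_desc hx hxv
              exact hin u hu huv (hall u hu huv) hxu
        · exact hdesc
      rwa [this]
  obtain ⟨u, hu, huv, huS⟩ := hex
  refine ⟨⟨u, S', f'⟩, ⟨hu, huv, hsub, hdesc, hf'⟩, hout u hu huv huS, hup,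
    fun _ => hsub (Or.inl huv), hval, ?_⟩
  rintro ⟨g, hg, hgval⟩
  -- otherwise the subtree at `u` could be colored as well
  refine huS (hmax.le_of_ge (y := S' ∪ T.desc u) ⟨hsub.trans Set.subset_union_left, ?_, ?_, ?_, ?_,
    g, ?_, hgval⟩ Set.subset_union_left (Or.inr (ParentMap.self_mem_desc u)))
  · rintro x (hx | hx)
    · exact hdesc x hx
    · exact Or.inr (ParentMap.desc_trans hx ⟨1, huv⟩)
  · rintro x (hx | hx)
    · exact Or.inl (hup x hx)
    · by_cases hxu : x = u
      · rw [hxu, huv]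
        exact Or.inl (hsub (Or.inl rfl))
      · exact Or.inr (ParentMap.par_mem_desc hx hxu)
  · rintro w hw hwv hwS x (hx | hx) hxw
    · exact hout w hw hwv (fun h => hwS (Or.inl h)) x hx hxw
    · have := ParentMap.child_eq_of_mem_desc hw hu (hwv.trans huv.symm) hxw hx
      rw [this] at hwS
      exact hwS (Or.inr (ParentMap.self_mem_desc u))
  · rintro w hw hwv (hwS | hwS)
    · exact (hin w hw hwv hwS).trans Set.subset_union_left
    · have := ParentMap.child_eq_of_mem_desc hw hu (hwv.trans huv.symm)
        (ParentMap.self_mem_desc w) hwS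
      rw [this]
      exact Set.subset_union_right
  · intro x hx
    exact (hg x (hsub hx)).trans (hf' x hx)

variable (T δ L)

open Classical in
/-- A stuck state that follows when the next vertex receives the color `c`, if there is one. -/
noncomputable def next (σ : State V) (c : ℕ) : State V :=
  if h : ∃ σ', σ.Step T c σ' ∧ σ'.Stuck T δ L then h.choose else σ

/-- The state reached when the colors of the list `l`, newest first, are given to the vertices that
come next. It starts at the root, with no vertex colored. -/
noncomputable def ofList : List ℕ → State V
  | [] => ⟨T.root, ∅, fun _ => 0⟩
  | c :: l => (ofList l).next T δ L c

/-- All colors of the list `l` are admissible at the time they are given. -/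
def Good : List ℕ → Prop
  | [] => True
  | c :: l => Good l ∧ T.ValidOn δ L (insert (ofList T δ L l).v (ofList T δ L l).S)
      ((ofList T δ L l).recolor c)

/-- No valid coloring of the whole tree exists. -/
def NoColoring : Prop := ¬ ∃ g, T.ValidOn δ L Set.univ g

variable {T δ L}

theorem stuck_and_step [Finite V] (h0 : NoColoring T δ L) : ∀ l, Good T δ L l →
    (ofList T δ L l).Stuck T δ L ∧
      ∀ c, Good T δ L (c :: l) → (ofList T δ L l).Step T c (ofList T δ L (c :: l)) := by
  have hnext : ∀ l, (ofList T δ L l).Stuck T δ L → ∀ c, Good T δ L (c :: l) →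
      (ofList T δ L l).Step T c (ofList T δ L (c :: l)) ∧ (ofList T δ L (c :: l)).Stuck T δ L := by
    intro l hl c hc
    have h := hl.exists_step hc.2
    have he : ofList T δ L (c :: l) = h.choose := by
      rw [ofList, next, dif_pos h]
    rw [he]
    exact h.choose_spec
  have hst : ∀ l, Good T δ L l → (ofList T δ L l).Stuck T δ L := by
    intro l
    induction l with
    | nil =>
      intro _
      refine ⟨fun x hx => hx.elim, fun x hx => hx.elim, fun h => absurd rfl h,
        ⟨fun x hx => hx.elim, fun x hx => hx.elim, fun x hx => hx.elim⟩, ?_⟩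
      rintro ⟨g, -, hg⟩
      refine h0 ⟨g, ?_⟩
      convert hg
      exact (Set.eq_univ_of_forall fun x => Or.inr (ParentMap.mem_desc_root x)).symm
    | cons c l ih => exact fun h => (hnext l (ih h.1) c h).2
  exact fun l hl => ⟨hst l hl, fun c hc => (hnext l (hst l hl) c hc).1⟩

theorem Good.stuck [Finite V] (h0 : NoColoring T δ L) {l : List ℕ} (hl : Good T δ L l) :
    (ofList T δ L l).Stuck T δ L := (stuck_and_step h0 l hl).1

theorem Good.step [Finite V] (h0 : NoColoring T δ L) {c : ℕ} {l : List ℕ}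
    (hl : Good T δ L (c :: l)) : (ofList T δ L l).Step T c (ofList T δ L (c :: l)) :=
  (stuck_and_step h0 l hl.1).2 c hl

theorem Good.drop : ∀ {l : List ℕ} (i : ℕ), Good T δ L l → Good T δ L (l.drop i)
  | _, 0, h => by simpa using h
  | [], i + 1, h => by simpa using h
  | _ :: _, i + 1, h => by simpa using Good.drop i h.1

theorem Stuck.iterate_mem {σ : State V} (hσ : σ.Stuck T δ L) {x : V} (hx : x ∈ σ.S) (i : ℕ) :
    T.par^[i] x ∈ σ.S := by
  induction i with
  | zero => exact hx
  | succ i ih => rw [Function.iterate_succ_apply']; exact hσ.par_mem _ ih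

theorem Stuck.iterate_v_mem {σ : State V} (hσ : σ.Stuck T δ L) (hv : σ.v ≠ T.root) {i : ℕ}
    (hi : 1 ≤ i) : T.par^[i] σ.v ∈ σ.S := by
  obtain ⟨j, rfl⟩ : ∃ j, i = j + 1 := ⟨i - 1, by omega⟩
  rw [Function.iterate_succ_apply]
  exact hσ.iterate_mem (hσ.par_v_mem hv) j

theorem Good.dep_v [Finite V] (h0 : NoColoring T δ L) :
    ∀ {l : List ℕ}, Good T δ L l → T.dep (ofList T δ L l).v = l.length
  | [], _ => T.dep_root
  | c :: l, h => by
    have hs := h.step h0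
    have := T.dep_par _ hs.v_ne
    rw [hs.par_v, Good.dep_v h0 h.1] at this
    rw [← this, List.length_cons]

/-- The relation between the state reached by a list and an earlier one: the next vertex of the
earlier state is an ancestor, and the later state has in addition colored only descendants of
it. -/
theorem Good.drop_state [Finite V] (h0 : NoColoring T δ L) : ∀ {l : List ℕ} (i : ℕ),
    Good T δ L l → i ≤ l.length →
      (ofList T δ L (l.drop i)).v = T.par^[i] (ofList T δ L l).v ∧
      (∀ x ∈ (ofList T δ L (l.drop i)).S, x ∈ (ofList T δ L l).S ∧
        (ofList T δ L l).f x = (ofList T δ L (l.drop i)).f x) ∧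
      ∀ x ∈ (ofList T δ L l).S, x ∉ T.desc (ofList T δ L (l.drop i)).v →
        x ∈ (ofList T δ L (l.drop i)).S
  | _, 0, _, _ => by simp +contextual
  | [], i + 1, _, hi => by simp at hi
  | c :: l, i + 1, h, hi => by
    have hs := h.step h0
    have hst := h.1.stuck h0
    obtain ⟨h1, h2, h3⟩ := Good.drop_state h0 (l := l) i h.1 (by simpa using hi)
    rw [List.drop_succ_cons]
    refine ⟨by rw [h1, Function.iterate_succ_apply, hs.par_v], fun x hx => ?_, fun x hx hxd => ?_⟩
    · obtain ⟨h4, h5⟩ := h2 x hx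
      refine ⟨hs.subset (Or.inr h4), ?_⟩
      rw [hs.agree x (Or.inr h4), hst.recolor_eq c h4, h5]
    · rcases hs.sub_desc x hx with h4 | h4
      · exact h3 x h4 hxd
      · exact absurd (ParentMap.desc_trans h4 ⟨i, h1.symm⟩) hxd

/-- The colors of the ancestors of the next vertex are the entries of the list. -/
theorem Good.getElem?_eq [Finite V] (h0 : NoColoring T δ L) : ∀ {l : List ℕ} (i : ℕ),
    Good T δ L l → i < l.length →
      l[i]? = some ((ofList T δ L l).f (T.par^[i + 1] (ofList T δ L l).v))
  | [], i, _, hi => by simp at hi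
  | c :: l, 0, h, _ => by
    have hs := h.step h0
    rw [zero_add, Function.iterate_one, hs.par_v, hs.agree _ (Or.inl rfl), recolor_v]
    rfl
  | c :: l, i + 1, h, hi => by
    have hs := h.step h0
    have hst := h.1.stuck h0
    have hi' : i < l.length := by simpa using hi
    have hv : (ofList T δ L l).v ≠ T.root := by
      intro hr
      have := h.1.dep_v h0
      rw [hr, T.dep_root] at this
      omega
    have hmem := hst.iterate_v_mem hv (i := i + 1) (by omega)
    rw [List.getElem?_cons_succ, Good.getElem?_eq h0 i h.1 hi',
      Function.iterate_succ_apply T.par (i + 1), hs.par_v, hs.agree _ (Or.inr hmem),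
      hst.recolor_eq c hmem]

end State
end States

/-! ### Defects and what can be recovered after erasing -/

section Defects

theorem list_ext_of_drop_eq {α : Type*} {x y : List α} {s : ℕ} (hd : x.drop s = y.drop s)
    (h : ∀ i < s, x[i]? = y[i]?) : x = y := by
  refine List.ext_getElem? fun i => ?_
  rcases lt_or_ge i s with hi | hi
  · exact h i hi
  · have := congrArg (fun z => z[i - s]?) hd
    simpa [List.getElem?_drop, Nat.add_sub_cancel' hi] using this

namespace State

variable {V : Type*} {T : ParentMap V} {δ : ℝ} {L : V → Finset ℕ}

theorem Good.cons_getElem?_eq [Finite V] (h0 : NoColoring T δ L) {c : ℕ} {l : List ℕ}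
    (hl : Good T δ L l) {i : ℕ} (hi : i ≤ T.dep (ofList T δ L l).v) :
    (c :: l)[i]? =
      some ((ofList T δ L l).recolor c (T.par^[i] (ofList T δ L l).v)) := by
  have hd := hl.dep_v h0
  have hst := hl.stuck h0
  cases i with
  | zero => simp [recolor_v]
  | succ i =>
    have hv : (ofList T δ L l).v ≠ T.root := by
      intro hr
      rw [hr, T.dep_root] at hi
      omega
    rw [List.getElem?_cons_succ, hl.getElem?_eq h0 i (by omega),
      hst.recolor_eq c (hst.iterate_v_mem hv (by omega))]

variable (T δ L)

/-- The defects of a list whose last color is not admissible: a forbidden vertical path of base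
length `n` at the vertex colored last, or a bent repetition with `2 * h` vertices which climbs
`a` steps from that vertex and therefore descends `2 * h - 1 - a` steps. -/
def Defect : ℕ ⊕ (ℕ × ℕ) → List ℕ → Prop
  | _, [] => False
  | .inl n, c :: l => T.VertBad δ ((ofList T δ L l).recolor c) (ofList T δ L l).v n
  | .inr p, c :: l => ∃ y ∈ (ofList T δ L l).S,
      T.BentBad ((ofList T δ L l).recolor c) (ofList T δ L l).v y p.1 (2 * p.2 - 1 - p.1) p.2

/-- The number of colors that are erased on account of a defect. -/
noncomputable def erased (δ : ℝ) : ℕ ⊕ (ℕ × ℕ) → ℕ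
  | .inl n => ⌈δ * n⌉₊
  | .inr p => min p.1 p.2

/-- The number of lists with a given defect that become equal when the colors are erased: for a
bent repetition the other end of the path has to be known. -/
def multiplicity (Δ : ℕ) : ℕ ⊕ (ℕ × ℕ) → ℕ
  | .inl _ => 1
  | .inr p => Δ ^ (2 * p.2 - 1 - p.1)

/-- The pairs `(a, h)` for which a bent repetition with `2 * h` vertices can climb `a` steps from
the vertex colored last, in a tree with `n` vertices whose descending legs are free of forbidden
vertical paths. -/
noncomputable def bentIndices (δ : ℝ) (n : ℕ) : Finset (ℕ × ℕ) :=
  (Finset.range n ×ˢ Finset.range n).filter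
    fun p => (1 - δ) * (p.2 : ℝ) < p.1 ∧ p.1 + 2 ≤ 2 * p.2

variable {T δ L}

theorem ceil_mul_le (hδ : δ < 1) (n : ℕ) : ⌈δ * n⌉₊ ≤ n := by
  rw [Nat.ceil_le]
  nlinarith [Nat.cast_nonneg (α := ℝ) n]

theorem one_le_ceil_mul (hδ : 0 < δ) {n : ℕ} (hn : 1 ≤ n) : 1 ≤ ⌈δ * n⌉₊ := by
  rw [Nat.one_le_ceil_iff]
  have : (0 : ℝ) < n := by exact_mod_cast hn
  positivity

theorem Defect.erased_le [Finite V] (h0 : NoColoring T δ L) (hδ0 : 0 < δ) (hδ1 : δ < 1)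
    {i : ℕ ⊕ (ℕ × ℕ)} {c : ℕ} {l : List ℕ} (hl : Good T δ L l) (h : Defect T δ L i (c :: l)) :
    1 ≤ erased δ i ∧ erased δ i ≤ (c :: l).length := by
  have hd := hl.dep_v h0
  rw [List.length_cons]
  cases i with
  | inl n =>
    have h1 := h.1
    have h2 := h.2.1
    have h3 := ceil_mul_le hδ1 n
    exact ⟨one_le_ceil_mul hδ0 h1, show ⌈δ * n⌉₊ ≤ _ by omega⟩
  | inr p =>
    obtain ⟨y, -, h⟩ := h
    have h1 := h.one_le_left
    have h2 := h.le_dep_left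
    have h3 := h.length
    simp only [erased]
    omega

/-- A coloring of the descending leg of a bent repetition that is free of forbidden vertical paths
forces this leg to be short, and the climbing leg to be long. -/
theorem bent_length_lt {f : V → ℕ} {x y : V} {a b h : ℕ} (H : T.BentBad f x y a b h)
    (hy : ∀ n, ¬ T.VertBad δ f y n) (hδ0 : 0 < δ) :
    (1 - δ) * (h : ℝ) < a := by
  have hl := H.length
  have h1 := H.one_le_left
  have hh : 1 ≤ h := by omega
  by_contra! hcon
  have hlen : h + ⌈δ * h⌉₊ ≤ b + 1 := by
    have : ⌈δ * h⌉₊ ≤ h - a := by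
      have hah : a ≤ h := by
        have : (a : ℝ) ≤ h := by nlinarith [Nat.cast_nonneg (α := ℝ) h]
        exact_mod_cast this
      rw [Nat.ceil_le, Nat.cast_sub hah]
      linarith
    have := H.one_le_right
    have := one_le_ceil_mul hδ0 hh
    omega
  refine hy h ⟨hh, hlen.trans (by have := H.le_dep_right; omega), fun i hi => ?_⟩
  have hs := H.symm.rep i (by omega)
  unfold ParentMap.legVertex at hs
  rwa [if_pos (by omega), if_pos (by omega)] at hs

theorem exists_defect [Fintype V] (h0 : NoColoring T δ L) (hδ0 : 0 < δ)
    {l : List ℕ} (hl : Good T δ L l) {c : ℕ} (hc : c ∈ L (ofList T δ L l).v)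
    (hbad : ¬ Good T δ L (c :: l)) :
    ∃ i ∈ (Finset.range (Fintype.card V + 1)).disjSum (bentIndices δ (Fintype.card V)),
      Defect T δ L i (c :: l) := by
  have hst := hl.stuck h0
  set σ := ofList T δ L l with hσ
  by_contra! hno
  have hval : T.ValidOn δ L σ.S (σ.recolor c) :=
    hst.valid.congr hst.par_mem fun x hx => hst.recolor_eq c hx
  have hvert : ∀ n, ¬ T.VertBad δ (σ.recolor c) σ.v n := by
    intro n hn
    refine hno (.inl n) ?_ hn
    rw [Finset.inl_mem_disjSum, Finset.mem_range]
    have := hn.2.1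
    have := T.dep_lt_card σ.v
    omega
  have hbent : ∀ y ∈ σ.S, ∀ a b h, ¬ T.BentBad (σ.recolor c) σ.v y a b h := by
    intro y hy a b h H
    have hl := H.length
    have h1 := H.one_le_right
    have h2 := H.le_dep_left
    have h3 := H.le_dep_right
    have h4 := T.dep_lt_card σ.v
    have h5 := T.dep_lt_card y
    refine hno (.inr (a, h)) ?_ ⟨y, hy, ?_⟩
    · rw [Finset.inr_mem_disjSum, bentIndices, Finset.mem_filter, Finset.mem_product,
        Finset.mem_range, Finset.mem_range]
      exact ⟨⟨by simp only; omega, by simp only; omega⟩,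
        bent_length_lt H (hval.vert y hy) hδ0, by simp only; omega⟩
    · rwa [show 2 * h - 1 - a = b by omega]
  refine hbad ⟨hl, ?_, ?_, ?_⟩
  · rintro x (rfl | hx)
    · rwa [recolor_v]
    · exact hval.mem x hx
  · rintro x (rfl | hx)
    · exact hvert
    · exact hval.vert x hx
  · rintro x (rfl | hx) y (rfl | hy) a b h H
    · exact H.left_ne_right rfl
    · exact hbent y hy a b h H
    · exact hbent x hx b a h H.symm
    · exact hval.bent x hx y hy a b h H

/-- The erased colors of a list with a bent repetition are the colors of the other half of the
path, all of which can be read off from the state before the erased colors were given. -/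
theorem getElem?_of_bent [Finite V] (h0 : NoColoring T δ L) {c : ℕ} {l : List ℕ}
    (hl : Good T δ L l) {y : V} (hy : y ∈ (ofList T δ L l).S) {a b h : ℕ}
    (H : T.BentBad ((ofList T δ L l).recolor c) (ofList T δ L l).v y a b h) {l' : List ℕ}
    (hl' : (c :: l).drop (min a h) = l') :
    T.par^[b] y = T.par^[a - (min a h - 1)] (ofList T δ L l').v ∧
    ∀ i < min a h, (c :: l)[i]? = some ((ofList T δ L l').f
      (if i + h ≤ a then T.par^[i + h - (min a h - 1)] (ofList T δ L l').v
        else T.par^[a + b - (i + h)] y)) := by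
  have hd := hl.dep_v h0
  have hst := hl.stuck h0
  have h1 := H.one_le_left
  have h2 := H.le_dep_left
  have h3 := H.length
  obtain ⟨k, hk⟩ : ∃ k, min a h = k + 1 := ⟨min a h - 1, by omega⟩
  rw [hk, List.drop_succ_cons] at hl'
  subst hl'
  rw [hk, Nat.add_sub_cancel]
  obtain ⟨hv, hsub, hback⟩ := hl.drop_state h0 k (by omega)
  have hst' := (hl.drop k).stuck h0
  set σ := ofList T δ L l
  set σ' := ofList T δ L (l.drop k)
  have hroot : σ'.v ≠ T.root := by
    intro hr
    have := congrArg T.dep hv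
    rw [hr, T.dep_root, T.dep_iterate] at this
    omega
  have hcol : ∀ x ∈ σ'.S, σ.recolor c x = σ'.f x := fun x hx => by
    rw [hst.recolor_eq c (hsub x hx).1, (hsub x hx).2]
  have hiter : ∀ j, k ≤ j → T.par^[j] σ.v = T.par^[j - k] σ'.v := fun j hj => by
    rw [hv, ← Function.iterate_add_apply, Nat.sub_add_cancel hj]
  refine ⟨by rw [← H.top, hiter a (by omega)], fun i hi => ?_⟩
  have hrep := H.rep i (by omega)
  unfold ParentMap.legVertex at hrep
  rw [if_pos (by omega)] at hrep
  rw [hl.cons_getElem?_eq h0 (show i ≤ T.dep σ.v by omega), hrep]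
  congr 1
  split_ifs with hia
  · rw [hiter _ (by omega)]
    exact hcol _ (hst'.iterate_v_mem hroot (by omega))
  · refine hcol _ (hback _ (hst.iterate_mem hy _) ?_)
    rw [hv]
    exact H.not_mem_desc (by omega)

theorem card_le_multiplicity [Fintype V] [DecidableEq V] (h0 : NoColoring T δ L) (hδ1 : δ < 1)
    {Δ : ℕ} (hΔ : ∀ w, (Finset.univ.filter fun x => x ≠ T.root ∧ T.par x = w).card ≤ Δ)
    (i : ℕ ⊕ (ℕ × ℕ)) (l' : List ℕ) (X : Finset (List ℕ))
    (hX : ∀ x ∈ X, Defect T δ L i x ∧ x.drop (erased δ i) = l' ∧ ∃ l c, x = c :: l ∧ Good T δ L l) :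
    X.card ≤ multiplicity Δ i := by
  classical
  cases i with
  | inl n =>
    have key : ∀ x ∈ X, ∀ i < ⌈δ * n⌉₊, x[i]? = l'[i + n - ⌈δ * n⌉₊]? := by
      intro x hx i hi
      obtain ⟨hd, rfl, l, c, rfl, hl⟩ := hX x hx
      have h1 := hd.2.1
      have h2 := ceil_mul_le hδ1 n
      rw [List.getElem?_drop, show erased δ (.inl n) = ⌈δ * n⌉₊ from rfl,
        show ⌈δ * n⌉₊ + (i + n - ⌈δ * n⌉₊) = i + n by omega,
        hl.cons_getElem?_eq h0 (by omega), hl.cons_getElem?_eq h0 (by omega), hd.2.2 i hi]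
    refine Finset.card_le_one.2 fun x hx y hy => ?_
    exact list_ext_of_drop_eq ((hX x hx).2.1.trans (hX y hy).2.1.symm)
      fun i hi => (key x hx i hi).trans (key y hy i hi).symm
  | inr p =>
    obtain ⟨a, h⟩ := p
    have key : ∀ x ∈ X, ∃ y, a + (2 * h - 1 - a) + 1 = 2 * h ∧ 2 * h - 1 - a ≤ T.dep y ∧
        T.par^[2 * h - 1 - a] y = T.par^[a - (min a h - 1)] (ofList T δ L l').v ∧
        ∀ i < min a h, x[i]? = some ((ofList T δ L l').f
          (if i + h ≤ a then T.par^[i + h - (min a h - 1)] (ofList T δ L l').v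
            else T.par^[a + (2 * h - 1 - a) - (i + h)] y)) := by
      intro x hx
      obtain ⟨hdef, hd, l, c, rfl, hl⟩ := hX x hx
      obtain ⟨y, hy, H⟩ := hdef
      obtain ⟨h1, h2⟩ := getElem?_of_bent h0 hl hy H hd
      exact ⟨y, H.length, H.le_dep_right, h1, h2⟩
    have : Nonempty V := ⟨T.root⟩
    choose! y hlen hdep hit hcol using key
    refine le_trans ?_ (ParentMap.card_iterate_le hΔ (2 * h - 1 - a)
      (T.par^[a - (min a h - 1)] (ofList T δ L l').v))
    refine Finset.card_le_card_of_injOn y (fun x hx => ?_) fun x hx x' hx' hxx' => ?_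
    · exact Finset.mem_coe.2 (Finset.mem_filter.2 ⟨Finset.mem_univ _, hdep x hx, hit x hx⟩)
    · refine list_ext_of_drop_eq ((hX x hx).2.1.trans (hX x' hx').2.1.symm) fun i hi => ?_
      rw [hcol x hx i hi, hcol x' hx' i hi, hxx']

/-- If the lists are large enough for the counting argument, the whole tree has a valid coloring:
otherwise there would be arbitrarily long sequences of admissible colors, and the vertices that
receive them form a path that descends from the root. -/
theorem exists_validOn [Fintype V] [DecidableEq V] (hδ0 : 0 < δ) (hδ1 : δ < 1)
    {Δ : ℕ} (hΔ : ∀ w, (Finset.univ.filter fun x => x ≠ T.root ∧ T.par x = w).card ≤ Δ)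
    {β : ℝ} (hβ : 0 < β)
    (hL : ∀ v, β + ∑ i ∈ (Finset.range (Fintype.card V + 1)).disjSum
      (bentIndices δ (Fintype.card V)),
        (multiplicity Δ i : ℝ) * (β ^ (erased δ i - 1))⁻¹ ≤ ((L v).card : ℝ)) :
    ∃ g, T.ValidOn δ L Set.univ g := by
  by_contra h0
  change NoColoring T δ L at h0
  set A : List ℕ → Finset ℕ := fun l => L (ofList T δ L l).v
  have hgrow := mul_card_goodLists_le A (Good T δ L) trivial
    ((Finset.range (Fintype.card V + 1)).disjSum (bentIndices δ (Fintype.card V)))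
    (erased δ) (multiplicity Δ)
    (fun i x => ∃ l c, x = c :: l ∧ Good T δ L l ∧ Defect T δ L i x) β hβ (fun l _ => hL _)
    (fun l hl c hc hbad => by
      obtain ⟨i, hi, hd⟩ := exists_defect h0 hδ0 hl hc hbad
      exact ⟨i, hi, l, c, rfl, hl, hd⟩)
    (by
      rintro i x ⟨l, c, rfl, hl, hd⟩
      exact hd.erased_le h0 hδ0 hδ1 hl)
    (fun i l' _ X hX => card_le_multiplicity h0 hδ1 hΔ i l' X fun x hx => by
      obtain ⟨⟨l, c, hx1, hl, hd⟩, hdr, -⟩ := hX x hx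
      exact ⟨hd, hdr, l, c, hx1, hl⟩)
  have hpos : ∀ t, 0 < ((goodLists A (Good T δ L) t).card : ℝ) := by
    intro t
    induction t with
    | zero => simp [goodLists]
    | succ t ih => exact (mul_pos hβ ih).trans_le (hgrow t)
  obtain ⟨l, hl⟩ := Finset.card_pos.1 (Nat.cast_pos.1 (hpos (Fintype.card V)))
  have h1 := (good_of_mem_goodLists (A := A) trivial hl).dep_v h0
  have h2 := length_of_mem_goodLists hl
  have h3 := T.dep_lt_card (ofList T δ L l).v
  omega

end State
end Defects

/-! ### Estimates -/

section Estimates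

theorem sum_geometric_le {r : ℝ} (h0 : 0 ≤ r) (h1 : r < 1) (s : Finset ℕ) :
    ∑ n ∈ s, r ^ n ≤ (1 - r)⁻¹ := by
  rw [← tsum_geometric_of_lt_one h0 h1]
  exact (summable_geometric_of_lt_one h0 h1).sum_le_tsum s fun n _ => pow_nonneg h0 n

theorem sum_vertical_le {δ β : ℝ} (hδ : 0 < δ) (hβ : 16 ≤ β) (s : Finset ℕ) :
    ∑ n ∈ s, (β ^ (⌈δ * n⌉₊ - 1))⁻¹ ≤ 16 * (1 - (16 : ℝ) ^ (-δ))⁻¹ := by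
  have hr0 : (0 : ℝ) ≤ (16 : ℝ) ^ (-δ) := by positivity
  have hr1 : (16 : ℝ) ^ (-δ) < 1 := Real.rpow_lt_one_of_one_lt_of_neg (by norm_num) (by linarith)
  refine le_trans ?_ (mul_le_mul_of_nonneg_left (sum_geometric_le hr0 hr1 s) (by norm_num))
  rw [Finset.mul_sum]
  refine Finset.sum_le_sum fun n _ => ?_
  have h1 : (16 : ℝ) ^ (δ * n) ≤ 16 * 16 ^ (⌈δ * n⌉₊ - 1) := by
    calc (16 : ℝ) ^ (δ * n) ≤ (16 : ℝ) ^ ((⌈δ * n⌉₊ : ℕ) : ℝ) :=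
          Real.rpow_le_rpow_of_exponent_le (by norm_num) (Nat.le_ceil _)
      _ = 16 ^ ⌈δ * n⌉₊ := Real.rpow_natCast _ _
      _ ≤ 16 ^ (⌈δ * n⌉₊ - 1 + 1) := pow_le_pow_right₀ (by norm_num) (by omega)
      _ = _ := pow_succ' _ _
  have h2 : ((16 : ℝ) ^ (-δ)) ^ n = ((16 : ℝ) ^ (δ * n))⁻¹ := by
    rw [← Real.rpow_natCast, ← Real.rpow_mul (by norm_num), ← Real.rpow_neg (by norm_num)]
    ring_nf
  have h3 : (0 : ℝ) < 16 ^ (δ * n) := by positivity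
  calc (β ^ (⌈δ * n⌉₊ - 1))⁻¹ ≤ ((16 : ℝ) ^ (⌈δ * n⌉₊ - 1))⁻¹ := by gcongr
    _ ≤ 16 * ((16 : ℝ) ^ (δ * n))⁻¹ := by
        rw [← div_eq_mul_inv, le_div_iff₀ h3, inv_mul_le_iff₀ (by positivity)]
        linarith
    _ = _ := by rw [h2]

theorem bent_term_le {ε δ : ℝ} (hδ0 : 0 < δ) (hδ1 : δ ≤ 1 / 2)
    (hεδ : 1 + ε = (1 + δ) / (1 - δ)) {Δ : ℕ} (hΔ : 1 ≤ Δ) {a h : ℕ}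
    (ha : (1 - δ) * (h : ℝ) < a) (hah : a + 2 ≤ 2 * h) :
    ((Δ ^ (2 * h - 1 - a) : ℕ) : ℝ) * ((16 * (Δ : ℝ) ^ (1 + ε)) ^ (min a h - 1))⁻¹ ≤
      (Δ : ℝ) ^ (1 + ε) * (16 * ((3 / 4) ^ a * (1 / 2) ^ h)) := by
  have hD : (1 : ℝ) ≤ Δ := by exact_mod_cast hΔ
  have hh : (1 : ℝ) ≤ h := by exact_mod_cast (by omega : 1 ≤ h)
  set B := (Δ : ℝ) ^ (1 + ε) with hB
  have hB0 : 0 < B := by positivity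
  obtain ⟨s, hs⟩ : ∃ s, s = min a h := ⟨_, rfl⟩
  rw [← hs]
  have hs' : (1 - δ) * (h : ℝ) < s := by
    rcases le_total a h with hle | hle
    · rw [hs, min_eq_left hle]; exact ha
    · rw [hs, min_eq_right hle]; nlinarith
  have hs1 : 1 ≤ s := by
    have : (0 : ℝ) < s := lt_of_le_of_lt (by nlinarith) hs'
    exact_mod_cast this
  have hhs : h ≤ 2 * s := by
    have : (h : ℝ) ≤ 2 * s := by nlinarith
    exact_mod_cast this
  -- the possible ends of the path are outweighed by the colors that are erased
  have hpow : ((Δ ^ (2 * h - 1 - a) : ℕ) : ℝ) ≤ B ^ s := by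
    rw [hB, ← Real.rpow_natCast (_ ^ _), ← Real.rpow_mul (by positivity), Nat.cast_pow,
      ← Real.rpow_natCast]
    refine Real.rpow_le_rpow_of_exponent_le hD ?_
    rw [Nat.sub_sub, Nat.cast_sub (by omega), hεδ, div_mul_eq_mul_div, le_div_iff₀ (by linarith)]
    push_cast
    nlinarith
  obtain ⟨k, rfl⟩ : ∃ k, s = k + 1 := ⟨s - 1, by omega⟩
  rw [Nat.add_sub_cancel]
  calc ((Δ ^ (2 * h - 1 - a) : ℕ) : ℝ) * ((16 * B) ^ k)⁻¹
      ≤ B ^ (k + 1) * ((16 * B) ^ k)⁻¹ := by gcongr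
    _ = B * (16 * (1 / 16) ^ (k + 1)) := by
        rw [mul_pow, pow_succ, pow_succ, one_div, inv_pow]
        field_simp
    _ = B * (16 * (1 / 4) ^ (2 * (k + 1))) := by
        rw [pow_mul]
        norm_num
    _ ≤ B * (16 * (1 / 4) ^ h) := by
        gcongr B * (16 * ?_)
        exact pow_le_pow_of_le_one (by norm_num) (by norm_num) hhs
    _ = B * (16 * ((1 / 2) ^ h * (1 / 2) ^ h)) := by
        rw [← mul_pow]
        norm_num
    _ ≤ B * (16 * ((3 / 4) ^ a * (1 / 2) ^ h)) := by
        gcongr B * (16 * (?_ * _))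
        calc (1 / 2 : ℝ) ^ h ≤ (9 / 16) ^ h := pow_le_pow_left₀ (by norm_num) (by norm_num) _
          _ = (3 / 4) ^ (2 * h) := by rw [pow_mul]; norm_num
          _ ≤ (3 / 4) ^ a := pow_le_pow_of_le_one (by norm_num) (by norm_num) (by omega)

theorem sum_bent_le {ε δ : ℝ} (hδ0 : 0 < δ) (hδ1 : δ ≤ 1 / 2)
    (hεδ : 1 + ε = (1 + δ) / (1 - δ)) {Δ : ℕ} (hΔ : 1 ≤ Δ) (n : ℕ) :
    ∑ p ∈ State.bentIndices δ n, ((Δ ^ (2 * p.2 - 1 - p.1) : ℕ) : ℝ) *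
      ((16 * (Δ : ℝ) ^ (1 + ε)) ^ (min p.1 p.2 - 1))⁻¹ ≤ 128 * (Δ : ℝ) ^ (1 + ε) := by
  have hB0 : (0 : ℝ) ≤ (Δ : ℝ) ^ (1 + ε) := by positivity
  calc _ ≤ ∑ p ∈ State.bentIndices δ n,
        (Δ : ℝ) ^ (1 + ε) * (16 * ((3 / 4) ^ p.1 * (1 / 2) ^ p.2)) := by
        refine Finset.sum_le_sum fun p hp => ?_
        obtain ⟨-, h1, h2⟩ := Finset.mem_filter.1 hp
        exact bent_term_le hδ0 hδ1 hεδ hΔ h1 h2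
    _ ≤ ∑ p ∈ Finset.range n ×ˢ Finset.range n,
        (Δ : ℝ) ^ (1 + ε) * (16 * ((3 / 4) ^ p.1 * (1 / 2) ^ p.2)) :=
        Finset.sum_le_sum_of_subset_of_nonneg (Finset.filter_subset _ _)
          fun p _ _ => by positivity
    _ = (Δ : ℝ) ^ (1 + ε) * (16 * ((∑ a ∈ Finset.range n, (3 / 4 : ℝ) ^ a) *
        ∑ h ∈ Finset.range n, (1 / 2 : ℝ) ^ h)) := by
        rw [Finset.sum_mul_sum, ← Finset.sum_product', Finset.mul_sum, Finset.mul_sum]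
    _ ≤ (Δ : ℝ) ^ (1 + ε) * (16 * ((1 - 3 / 4)⁻¹ * (1 - 1 / 2)⁻¹)) := by
        gcongr
        · exact sum_geometric_le (by norm_num) (by norm_num) _
        · exact sum_geometric_le (by norm_num) (by norm_num) _
    _ = _ := by ring

/-- The list size, divided by `Δ ^ (1 + ε)`, that the counting argument needs: the number of
admissible color sequences grows by the factor `16 * Δ ^ (1 + ε)`, and the other two terms pay for
the bent and the vertical paths. -/
noncomputable def listConstant (δ : ℝ) : ℝ := 16 + 128 + 16 * (1 - (16 : ℝ) ^ (-δ))⁻¹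

theorem sum_defects_le {ε δ : ℝ} (hε : 0 < ε) (hδ0 : 0 < δ) (hδ1 : δ ≤ 1 / 2)
    (hεδ : 1 + ε = (1 + δ) / (1 - δ)) {Δ : ℕ} (hΔ : 1 ≤ Δ) (n : ℕ) :
    16 * (Δ : ℝ) ^ (1 + ε) + ∑ i ∈ (Finset.range (n + 1)).disjSum (State.bentIndices δ n),
        (State.multiplicity Δ i : ℝ) *
          ((16 * (Δ : ℝ) ^ (1 + ε)) ^ (State.erased δ i - 1))⁻¹ ≤
      listConstant δ * (Δ : ℝ) ^ (1 + ε) := by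
  have hB1 : (1 : ℝ) ≤ (Δ : ℝ) ^ (1 + ε) :=
    Real.one_le_rpow (by exact_mod_cast hΔ) (by linarith)
  have hr1 : (16 : ℝ) ^ (-δ) < 1 := Real.rpow_lt_one_of_one_lt_of_neg (by norm_num) (by linarith)
  have hv : 0 ≤ 16 * (1 - (16 : ℝ) ^ (-δ))⁻¹ :=
    mul_nonneg (by norm_num) (inv_nonneg.2 (by linarith))
  rw [Finset.sum_disjSum]
  simp only [State.multiplicity, State.erased, Nat.cast_one, one_mul]
  have h1 := sum_vertical_le (β := 16 * (Δ : ℝ) ^ (1 + ε)) hδ0 (by linarith) (Finset.range (n + 1))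
  have h2 := sum_bent_le hδ0 hδ1 hεδ hΔ n
  unfold listConstant
  nlinarith

end Estimates

/-! ### Paths in trees -/

section Graphs

variable {V : Type*} {G : SimpleGraph V}

theorem exists_subpath {α : Type*} (f : V → α) {u v : V} (p : G.Walk u v) (hp : p.IsPath)
    {t : List α} (ht : t ≠ []) (h : t <:+: p.support.map f) :
    ∃ (u' v' : V) (q : G.Walk u' v'), q.IsPath ∧ q.support.map f = t := by
  obtain ⟨s₁, s₂, h⟩ := h
  have hlen := congrArg List.length h
  have ht' := List.length_pos_iff.2 ht
  simp only [List.length_append, List.length_map, SimpleGraph.Walk.length_support] at hlen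
  refine ⟨_, _, (p.drop s₁.length).take (t.length - 1), (hp.drop _).take _, ?_⟩
  rw [SimpleGraph.Walk.support_take, SimpleGraph.Walk.drop_support_eq_support_drop_min,
    min_eq_left (by omega), List.map_take, List.map_drop, ← h, List.append_assoc,
    List.drop_left, Nat.sub_add_cancel ht', List.take_left]

/-- The parent map of a tree with a chosen root: the parent of `x` is the second vertex on the
path from `x` to the root. -/
noncomputable def parentMap (hG : G.IsTree) (root : V) : ParentMap V where
  root := root
  par x := (hG.existsUnique_path x root).choose.snd
  dep x := (hG.existsUnique_path x root).choose.length
  par_root := by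
    have h := (hG.existsUnique_path root root).choose_spec
    rw [← h.2 .nil .nil]
    rfl
  dep_root := by
    have h := (hG.existsUnique_path root root).choose_spec
    rw [← h.2 .nil .nil]
    rfl
  dep_par x hx := by
    have h := (hG.existsUnique_path x root).choose_spec
    set p := (hG.existsUnique_path x root).choose
    have h' := (hG.existsUnique_path p.snd root).choose_spec
    rw [← h'.2 p.tail h.1.tail]
    exact SimpleGraph.Walk.length_tail_add_one (SimpleGraph.Walk.not_nil_of_ne hx)

theorem parentMap_adj (hG : G.IsTree) {root x : V} (hx : x ≠ root) :
    G.Adj x ((parentMap hG root).par x) :=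
  SimpleGraph.Walk.adj_snd (SimpleGraph.Walk.not_nil_of_ne hx)

/-- Every edge of `G` joins a vertex to its parent with respect to `T`. -/
def ParentMap.Orients (T : ParentMap V) (G : SimpleGraph V) : Prop :=
  ∀ ⦃x y : V⦄, G.Adj x y → (x ≠ T.root ∧ T.par x = y) ∨ (y ≠ T.root ∧ T.par y = x)

theorem parentMap_orients (hG : G.IsTree) (root : V) : (parentMap hG root).Orients G := by
  intro x y h
  change (x ≠ root ∧ _) ∨ (y ≠ root ∧ _)
  have hx := (hG.existsUnique_path x root).choose_spec
  have hy := (hG.existsUnique_path y root).choose_spec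
  by_cases hmem : y ∈ (hG.existsUnique_path x root).choose.support
  · refine Or.inl ⟨?_, (hG.isAcyclic.eq_snd_of_adj_start hx.1 h hmem).symm⟩
    rintro rfl
    rw [← hx.2 .nil .nil] at hmem
    simp at hmem
    exact h.ne hmem.symm
  · have hp := hy.2 (.cons h.symm _) (hx.1.cons hmem)
    refine Or.inr ⟨?_, ?_⟩
    · rintro rfl
      rw [← hy.2 .nil .nil] at hp
      cases hp
    · change (hG.existsUnique_path y root).choose.snd = x
      rw [← hp]
      simp

/-- A simple path of a rooted tree climbs towards the root for a while and then descends. -/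
theorem exists_legs {T : ParentMap V} (hT : T.Orients G) {x y : V} (p : G.Walk x y)
    (hp : p.IsPath) :
    ∃ a b, a ≤ T.dep x ∧ b ≤ T.dep y ∧ T.par^[a] x = T.par^[b] y ∧
      (1 ≤ a → 1 ≤ b → T.par^[a - 1] x ≠ T.par^[b - 1] y) ∧
      p.support = (List.range (a + b + 1)).map (T.legVertex x y a b) := by
  induction p with
  | nil => exact ⟨0, 0, by simp [ParentMap.legVertex]⟩
  | @cons x x' y hadj q ih =>
    obtain ⟨hq, hxq⟩ := (SimpleGraph.Walk.cons_isPath_iff _ _).1 hp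
    obtain ⟨a, b, ha, hb, htop, hne, hsupp⟩ := ih hq
    have hmem : ∀ i ≤ a + b, T.legVertex x' y a b i ∈ q.support := by
      intro i hi
      rw [hsupp]
      exact List.mem_map_of_mem (List.mem_range.2 (by omega))
    rcases hT hadj with ⟨hx, rfl⟩ | ⟨hx', hxx'⟩
    · have hd := T.dep_par x hx
      refine ⟨a + 1, b, by omega, hb, by rwa [Function.iterate_succ_apply], ?_, ?_⟩
      · intro _ hb1
        rw [Nat.add_sub_cancel]
        cases a with
        | zero =>
          intro he
          have := hmem 1 (by omega)
          rw [ParentMap.legVertex, if_neg (by omega), Nat.zero_add, ← he] at this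
          exact hxq this
        | succ a => exact hne (by omega) hb1
      · rw [SimpleGraph.Walk.support_cons, hsupp, show a + 1 + b + 1 = a + b + 1 + 1 by omega,
          List.range_succ_eq_map (n := a + b + 1), List.map_cons, List.map_map]
        congr 1
        refine List.map_congr_left fun i _ => ?_
        simp only [ParentMap.legVertex, Function.comp, Nat.succ_eq_add_one,
          Nat.add_le_add_iff_right, Function.iterate_succ_apply]
        rw [show a + 1 + b - (i + 1) = a + b - i by omega]
    · have ha0 : a = 0 := by
        by_contra h0
        have := hmem 1 (by omega)
        rw [ParentMap.legVertex, if_pos (by omega), Function.iterate_one, hxx'] at this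
        exact hxq this
      subst ha0
      have htop' : x' = T.par^[b] y := htop
      have hd := T.dep_par x' hx'
      have hd' := congrArg T.dep htop'
      rw [T.dep_iterate] at hd'
      refine ⟨0, b + 1, Nat.zero_le _, by omega, ?_, fun h => by omega, ?_⟩
      · rw [Function.iterate_succ_apply', ← htop', hxx']
        rfl
      · rw [SimpleGraph.Walk.support_cons, hsupp, ← Nat.add_assoc 0 b 1,
          List.range_succ_eq_map (n := 0 + b + 1), List.map_cons, List.map_map]
        congr 1
        refine List.map_congr_left fun i hi => ?_
        have hi' := List.mem_range.1 hi
        simp only [ParentMap.legVertex, Function.comp, Nat.succ_eq_add_one]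
        rw [if_neg (show ¬ i + 1 ≤ 0 by omega),
          show 0 + (b + 1) - (i + 1) = 0 + b - i by omega]
        split_ifs with h
        · obtain rfl : i = 0 := by omega
          rw [Nat.zero_add, Nat.sub_zero, ← htop']
          rfl
        · rfl

/-- The paths between a vertex and one of its ancestors have only one leg. -/
theorem legs_of_isDescendant {T : ParentMap V} (hT : T.Orients G) {x y : V}
    (h : IsDescendant G T.root x y) {a b : ℕ} (ha : a ≤ T.dep x) (hb : b ≤ T.dep y)
    (htop : T.par^[a] x = T.par^[b] y)
    (hne : 1 ≤ a → 1 ≤ b → T.par^[a - 1] x ≠ T.par^[b - 1] y) : b = 0 := by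
  obtain ⟨p, hp, hy⟩ := h
  obtain ⟨a', b', ha', hb', -, -, hsupp⟩ := exists_legs hT p hp
  have hr := T.dep_root
  obtain rfl : b' = 0 := by omega
  obtain ⟨i, hi, rfl⟩ : ∃ i ≤ T.dep x, T.par^[i] x = y := by
    rw [hsupp, List.mem_map] at hy
    obtain ⟨i, hi, rfl⟩ := hy
    have hi' := List.mem_range.1 hi
    refine ⟨i, by omega, ?_⟩
    rw [ParentMap.legVertex, if_pos (by omega)]
  have hd := congrArg T.dep htop
  rw [T.dep_iterate, T.dep_iterate, T.dep_iterate] at hd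
  rw [T.dep_iterate] at hb
  by_contra hb0
  refine hne (by omega) (by omega) ?_
  rw [← Function.iterate_add_apply]
  congr 2
  omega

theorem vertBad_of_period {T : ParentMap V} {δ : ℝ} {f : V → ℕ} {x y : V} {a b n : ℕ}
    (ha : a ≤ T.dep x) (hb : b ≤ T.dep y) (htop : T.par^[a] x = T.par^[b] y)
    (hab : a = 0 ∨ b = 0) (hn : 1 ≤ n) (hlen : n + ⌈δ * n⌉₊ ≤ a + b + 1)
    (h : ∀ i, i + n ≤ a + b → f (T.legVertex x y a b i) = f (T.legVertex x y a b (i + n))) :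
    T.VertBad δ f x n ∨ T.VertBad δ f y n := by
  -- the property of having period `n` does not depend on the direction of reading
  have aux : ∀ {x y : V} {a : ℕ}, a ≤ T.dep x → n + ⌈δ * n⌉₊ ≤ a + 1 →
      (∀ i, i + n ≤ a → f (T.legVertex x y a 0 i) = f (T.legVertex x y a 0 (i + n))) →
      T.VertBad δ f x n := by
    intro x y a ha hlen h
    refine ⟨hn, by omega, fun i hi => ?_⟩
    have := h i (by omega)
    unfold ParentMap.legVertex at this
    rwa [if_pos (by omega), if_pos (by omega)] at this
  rcases hab with rfl | rfl
  · refine Or.inr (aux (y := x) hb (by omega) fun i hi => ?_)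
    rw [T.legVertex_symm htop (by omega), T.legVertex_symm htop (by omega)]
    have := h (0 + b - (i + n)) (by omega)
    rw [this]
    congr 2
    omega
  · exact Or.inl (aux ha hlen h)

variable {root : V} {δ : ℝ} {L : V → Finset ℕ} {f : V → ℕ}

theorem isNonrepetitiveColoring_of_validOn (hG : G.IsTree) (hδ1 : δ < 1)
    (hf : (parentMap hG root).ValidOn δ L Set.univ f) : IsNonrepetitiveColoring G f := by
  rintro u v p hp t ht ⟨z, hz, rfl⟩
  obtain ⟨x, y, q, hq, hqz⟩ := exists_subpath f p hp (by simpa using hz) ht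
  obtain ⟨a, b, ha, hb, htop, hne, hsupp⟩ := exists_legs (parentMap_orients hG root) q hq
  set T := parentMap hG root
  have hz' := List.length_pos_iff.2 hz
  rw [hsupp, List.map_map] at hqz
  have hlen : a + b + 1 = 2 * z.length := by
    have := congrArg List.length hqz
    simp only [List.length_map, List.length_range, List.length_append] at this
    omega
  have hget : ∀ i, i ≤ a + b → (z ++ z)[i]? = some (f (T.legVertex x y a b i)) := by
    intro i hi
    rw [← hqz, List.getElem?_map, List.getElem?_range (by omega)]
    rfl
  have hrep : ∀ i < z.length,
      f (T.legVertex x y a b i) = f (T.legVertex x y a b (i + z.length)) := by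
    intro i hi
    have h1 := hget i (by omega)
    have h2 := hget (i + z.length) (by omega)
    rw [List.getElem?_append_left hi] at h1
    rw [List.getElem?_append_right (by omega), Nat.add_sub_cancel, h1] at h2
    exact Option.some.inj h2
  by_cases hab : a = 0 ∨ b = 0
  · have := State.ceil_mul_le hδ1 z.length
    rcases vertBad_of_period (δ := δ) ha hb htop hab hz' (by omega)
      (fun i hi => hrep i (by omega)) with h | h
    · exact hf.vert _ trivial _ h
    · exact hf.vert _ trivial _ h
  · push Not at hab
    exact hf.bent x trivial y trivial a b z.length ⟨by omega, by omega, ha, hb, hlen, htop,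
      hne (by omega) (by omega), hrep⟩

theorem isVerticallyPowerFree_of_validOn (hG : G.IsTree) (hδ0 : 0 < δ) (hδ1 : δ < 1)
    (hf : (parentMap hG root).ValidOn δ L Set.univ f) :
    IsVerticallyPowerFree G root (1 + δ) f := by
  rintro x y p hp hvert ⟨z, hz, hpz⟩
  have hceil : ⌈1 + δ⌉₊ = 2 := by
    rw [Nat.ceil_eq_iff (by norm_num)]
    norm_num
    exact ⟨hδ0, by linarith⟩
  have hfrac : 1 + δ - (((2 : ℕ) : ℝ) - 1) = δ := by push_cast; ring
  rw [hceil, hfrac, show 2 - 1 = 1 from rfl, List.replicate_one, List.flatten_singleton] at hpz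
  obtain ⟨a, b, ha, hb, htop, hne, hsupp⟩ := exists_legs (parentMap_orients hG root) p hp
  have hab : a = 0 ∨ b = 0 := by
    rcases hvert with h | h
    · exact Or.inr (legs_of_isDescendant (parentMap_orients hG root) h ha hb htop hne)
    · exact Or.inl (legs_of_isDescendant (parentMap_orients hG root) h hb ha htop.symm
        fun h1 h2 => (hne h2 h1).symm)
  set T := parentMap hG root
  have hz' := List.length_pos_iff.2 hz
  have hm := State.ceil_mul_le hδ1 z.length
  rw [hsupp, List.map_map] at hpz
  have hlen : a + b + 1 = z.length + ⌈δ * z.length⌉₊ := by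
    have := congrArg List.length hpz
    simp only [List.length_map, List.length_range, List.length_append, List.length_take] at this
    omega
  have hget : ∀ i, i ≤ a + b →
      (z ++ z.take ⌈δ * z.length⌉₊)[i]? = some (f (T.legVertex x y a b i)) := by
    intro i hi
    rw [← hpz, List.getElem?_map, List.getElem?_range (by omega)]
    rfl
  rcases vertBad_of_period (δ := δ) (n := z.length) (f := f) ha hb htop hab hz' (by omega)
    (fun i hi => by
      have h1 := hget i (by omega)
      have h2 := hget (i + z.length) hi
      rw [List.getElem?_append_left (by omega)] at h1
      rw [List.getElem?_append_right (by omega), Nat.add_sub_cancel,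
        List.getElem?_take_of_lt (by omega), h1] at h2
      exact Option.some.inj h2) with h | h
  · exact hf.vert _ trivial _ h
  · exact hf.vert _ trivial _ h

theorem card_children_le [Fintype V] [DecidableEq V] [DecidableRel G.Adj] (hG : G.IsTree)
    (w : V) : (Finset.univ.filter fun x =>
      x ≠ (parentMap hG root).root ∧ (parentMap hG root).par x = w).card ≤ G.maxDegree := by
  refine le_trans (Finset.card_le_card fun x hx => ?_) (G.degree_le_maxDegree w)
  obtain ⟨hne, rfl⟩ := (Finset.mem_filter.1 hx).2
  rw [SimpleGraph.mem_neighborFinset]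
  exact (parentMap_adj hG hne).symm

/-- Lists of size `listConstant δ * Δ ^ (1 + ε)` suffice for a nonrepetitive coloring without
vertical paths of the form `x^(1+δ)`. -/
theorem exists_coloring [Fintype V] [DecidableRel G.Adj] {ε : ℝ} (hε : 0 < ε)
    (hδ0 : 0 < δ) (hδ1 : δ ≤ 1 / 2) (hεδ : 1 + ε = (1 + δ) / (1 - δ)) (hG : G.IsTree)
    (root : V) {Δ : ℕ} (hΔ : 1 ≤ Δ) (hdeg : G.maxDegree ≤ Δ)
    (hL : ∀ v, listConstant δ * (Δ : ℝ) ^ (1 + ε) ≤ ((L v).card : ℝ)) :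
    ∃ f, IsChosenFrom f L ∧ IsNonrepetitiveColoring G f ∧
      IsVerticallyPowerFree G root (1 + δ) f := by
  classical
  have hD : (0 : ℝ) < Δ := by exact_mod_cast hΔ
  obtain ⟨f, hf⟩ := State.exists_validOn (T := parentMap hG root) (L := L) hδ0 (by linarith)
    (fun w => (card_children_le hG w).trans hdeg)
    (β := 16 * (Δ : ℝ) ^ (1 + ε)) (by positivity)
    (fun v => (sum_defects_le hε hδ0 hδ1 hεδ hΔ (Fintype.card V)).trans (hL v))
  exact ⟨f, fun v => hf.mem v trivial, isNonrepetitiveColoring_of_validOn hG (by linarith) hf,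
    isVerticallyPowerFree_of_validOn hG hδ0 (by linarith) hf⟩

theorem delta_bounds {ε δ : ℝ} (hε : 0 < ε) (hε1 : ε < 1) (h : 1 + ε = (1 + δ) / (1 - δ)) :
    0 < δ ∧ δ ≤ 1 / 2 := by
  have h1 : 1 - δ ≠ 0 := by
    intro h0
    rw [h0, div_zero] at h
    linarith
  rw [eq_div_iff h1] at h
  constructor <;> nlinarith

theorem thueChoiceNumber_le {k : ℕ} (h : IsThueChoosable G k) : thueChoiceNumber G ≤ k :=
  Nat.sInf_le h

end Graphs
end ThueChoice

theorem mainTheorem1 :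
    (∀ ε : ℝ, 0 < ε → ∃ c : ℝ,
      ∀ (V : Type*) [Fintype V] (G : SimpleGraph V) [DecidableRel G.Adj] (Δ : ℕ),
        G.IsTree → 1 ≤ Δ → G.maxDegree ≤ Δ →
          (ThueChoice.thueChoiceNumber G : ℝ) ≤ c * (Δ : ℝ) ^ (1 + ε) ∧
          ∀ L : V → Finset ℕ, (∀ v : V, c * (Δ : ℝ) ^ (1 + ε) ≤ ((L v).card : ℝ)) →
            ∃ f : V → ℕ, ThueChoice.IsChosenFrom f L ∧
              ThueChoice.IsNonrepetitiveColoring G f) ∧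
    (∀ ε δ : ℝ, 0 < ε → ε < 1 → 1 + ε = (1 + δ) / (1 - δ) → ∃ c : ℝ,
      ∀ (V : Type*) [Fintype V] (G : SimpleGraph V) [DecidableRel G.Adj] (Δ : ℕ) (root : V),
        G.IsTree → 1 ≤ Δ → G.maxDegree ≤ Δ →
          ∀ L : V → Finset ℕ, (∀ v : V, c * (Δ : ℝ) ^ (1 + ε) ≤ ((L v).card : ℝ)) →
            ∃ f : V → ℕ, ThueChoice.IsChosenFrom f L ∧
              ThueChoice.IsNonrepetitiveColoring G f ∧
              ThueChoice.IsVerticallyPowerFree G root (1 + δ) f) := by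
  refine ⟨fun ε hε => ?_, fun ε δ hε hε1 hεδ => ?_⟩
  · -- a smaller exponent is a stronger statement, so `ε` may be taken below `1`
    set η := min ε (1 / 2) with hη
    have hη0 : 0 < η := lt_min hε (by norm_num)
    have hη1 : η < 1 := (min_le_right _ _).trans_lt (by norm_num)
    set δ := η / (2 + η) with hδ
    have hηδ : 1 + η = (1 + δ) / (1 - δ) := by
      rw [hδ]
      have : (2 : ℝ) + η ≠ 0 := by positivity
      field_simp
      ring
    obtain ⟨hδ0, hδ1⟩ := ThueChoice.delta_bounds hη0 hη1 hηδ
    have hc : 0 ≤ ThueChoice.listConstant δ := by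
      have hr1 : (16 : ℝ) ^ (-δ) < 1 :=
        Real.rpow_lt_one_of_one_lt_of_neg (by norm_num) (by linarith)
      have := inv_nonneg.2 (sub_nonneg.2 hr1.le)
      unfold ThueChoice.listConstant
      positivity
    -- the summand `1` absorbs the rounding of the list size to an integer
    refine ⟨ThueChoice.listConstant δ + 1, fun V _ G _ Δ hG hΔ hdeg => ?_⟩
    have hD : (1 : ℝ) ≤ Δ := by exact_mod_cast hΔ
    have hpow : (Δ : ℝ) ^ (1 + η) ≤ (Δ : ℝ) ^ (1 + ε) :=
      Real.rpow_le_rpow_of_exponent_le hD (by linarith [min_le_left ε (1 / 2)])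
    have hB1 : (1 : ℝ) ≤ (Δ : ℝ) ^ (1 + ε) := Real.one_le_rpow hD (by linarith)
    obtain ⟨root⟩ := hG.connected.nonempty
    have main : ∀ L : V → Finset ℕ,
        (∀ v, ThueChoice.listConstant δ * (Δ : ℝ) ^ (1 + ε) ≤ ((L v).card : ℝ)) →
        ∃ f : V → ℕ, ThueChoice.IsChosenFrom f L ∧ ThueChoice.IsNonrepetitiveColoring G f := by
      intro L hL
      obtain ⟨f, h1, h2, -⟩ := ThueChoice.exists_coloring hη0 hδ0 hδ1 hηδ hG root hΔ hdeg
        fun v => (mul_le_mul_of_nonneg_left hpow hc).trans (hL v)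
      exact ⟨f, h1, h2⟩
    constructor
    · have hk : ThueChoice.IsThueChoosable G
          ⌈ThueChoice.listConstant δ * (Δ : ℝ) ^ (1 + ε)⌉₊ := fun L hL =>
        main L fun v => (Nat.le_ceil _).trans (by exact_mod_cast hL v)
      have h1 : (ThueChoice.thueChoiceNumber G : ℝ) ≤
          (⌈ThueChoice.listConstant δ * (Δ : ℝ) ^ (1 + ε)⌉₊ : ℕ) := by
        exact_mod_cast ThueChoice.thueChoiceNumber_le hk
      have h2 := Nat.ceil_lt_add_one (mul_nonneg hc (by linarith : 0 ≤ (Δ : ℝ) ^ (1 + ε)))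
      linarith
    · exact fun L hL => main L fun v => le_trans (by linarith) (hL v)
  · obtain ⟨hδ0, hδ1⟩ := ThueChoice.delta_bounds hε hε1 hεδ
    exact ⟨ThueChoice.listConstant δ, fun V _ G _ Δ root hG hΔ hdeg L hL =>
      ThueChoice.exists_coloring hε hδ0 hδ1 hεδ hG root hΔ hdeg hL⟩
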